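/- For a complex sequence $x=(x_k)_{k\ge1}$ with $\sum_{k}|x_kx_{k+1}|<\infty$ let \[ \mathfrak{F}(x)=1+\sum_{r=1}^{\infty}(-1)^{r}\sum_{k_{1}=1}^{\infty}\,\sum_{k_{2}=k_{1}+2}^{\infty}\cdots\sum_{k_{r}=k_{r-1}+2}^{\infty}x_{k_{1}}x_{k_{1}+1}x_{k_{2}}x_{k_{2}+1}\cdots x_{k_{r}}x_{k_{r}+1}, \] and let $\mathfrak{F}(x_1,\dots,x_N)=\mathfrak{F}(x_1,\dots,x_N,0,0,\dots)$, with $\mathfrak{F}(\emptyset)=1$. Let $J_\nu$ and $Y_\nu$ be the Bessel functions of the first and second kind. Then for all integers $0\le m\le n$, as $w\to0$ in $\mathbb{C}\setminus\{0\}$ (with principal branches of $Y_{n+1}$ and $\log$), \[ \pi J_{m}(2w)\,Y_{n+1}(2w)=-\frac{n!}{m!}\,w^{m-n-1}\,\mathfrak{F}\!\left(\frac{w}{m+1},\frac{w}{m+2},\dots,\frac{w}{n}\right)-\sum_{s=0}^{m-1}\frac{(m-s-1)!\,(n-m+2s+1)!}{s!\,(n+s+1)!\,(n-m+s+1)!}\,w^{n-m+2s+1}+O\big(w^{m+n+1}\log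 w\big). \] -/

import Mathlib

open Filter Topology Asymptotics
open scoped Nat

noncomputable section

/-- The nested sums
`∑_{k₁ ≥ j} ∑_{k₂ ≥ k₁ + 2} ⋯ ∑_{k_r ≥ k_{r-1} + 2} x_{k₁} x_{k₁+1} ⋯ x_{k_r} x_{k_r+1}`.
A sequence `x₁, x₂, …` is written `x : ℕ → ℂ` with `x i` standing for `x_{i+1}`. -/
def nestedSum (x : ℕ → ℂ) : ℕ → ℕ → ℂ
  | 0, _ => 1
  | r + 1, j => ∑' i : ℕ, x (j + i) * x (j + i + 1) * nestedSum x r (j + i + 2)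

/-- The function `𝔉(x) = 1 + ∑_{r ≥ 1} (-1)^r ∑_{k₁ ≥ 1} ∑_{k₂ ≥ k₁ + 2} ⋯`; it is meant for the
sequences with `∑ |x_k x_{k+1}| < ∞`, for which all the series converge absolutely. -/
def frakF (x : ℕ → ℂ) : ℂ :=
  1 + ∑' r : ℕ, (-1) ^ (r + 1) * nestedSum x (r + 1) 0

/-- `𝔉(x₁, …, x_N)` is `𝔉(x₁, …, x_N, 0, 0, …)`. -/
def frakFFin {N : ℕ} (x : Fin N → ℂ) : ℂ :=
  frakF fun i => if h : i < N then x ⟨i, h⟩ else 0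

/-- The Bessel function of the first kind (principal branch)
`J_ν(z) = (z/2)^ν ∑_k (-1)^k (z/2)^(2k) / (k! Γ(ν+k+1))`, where `1/Γ` vanishes at the
nonpositive integers (as Mathlib's `Gamma` is `0` there and `0⁻¹ = 0`). -/
def besselJ (ν z : ℂ) : ℂ :=
  (z / 2) ^ ν * ∑' k : ℕ, (-1) ^ k * (z / 2) ^ (2 * k) * ((k ! : ℂ) * Complex.Gamma (ν + k + 1))⁻¹

/-- The quotient `(J_ν(z) cos(πν) - J_{-ν}(z)) / sin(πν)`, for `ν` not an integer. -/
def besselYQuot (ν z : ℂ) : ℂ :=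
  (besselJ ν z * Complex.cos (Real.pi * ν) - besselJ (-ν) z) / Complex.sin (Real.pi * ν)

open Classical in
/-- The Bessel function of the second kind (principal branch): the above quotient, and its limiting
value if the order is an integer. -/
def besselY (ν z : ℂ) : ℂ :=
  if ∃ n : ℤ, ν = n then limUnder (𝓝[≠] ν) (fun μ => besselYQuot μ z) else besselYQuot ν z

end

/-! At integer order the quotient defining `besselY` is 0/0, so with N = n+1 L'Hôpital gives π Y_N =
∂J_ν/∂ν at N plus (-1)^N times the same derivative at -N (`pi_mul_besselY_nat`). Since 1/Γ vanishes
at -p with derivative (-1)^p p!, this yields π Y_N(2w) = -∑_{k≤n} (n-k)!/k! w^(2k-n-1) + O(w^(n+1)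
log w).

Multiplying by the series of J_m gives, for each l ≤ n, a coefficient of w^(2l+m-n-1) that is an
l-th finite difference of a quotient of factorials, hence a closed product
(`sum_factorial_alternating`). For l ≤ n-m it matches the coefficients of 𝔉, found by solving the
recursion of the nested sums (`nestedSum_arith`); for l = n-m+s+1 it is the s-th term of the second
sum. -/

/-! ### Alternating factorial sums -/

theorem fwdDiff_iter_factorial_div (a b l y : ℕ) :
    (fwdDiff 1)^[l] (fun j : ℕ => ((a + j)! : ℂ) / ((b + j)! : ℂ)) y
      = (-1) ^ l * (((a + y)! : ℂ) / ((b + y + l)! : ℂ)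
        * ∏ i ∈ Finset.range l, ((b : ℂ) - a + i)) := by
  induction l generalizing y with
  | zero => simp
  | succ l ih =>
    rw [Function.iterate_succ_apply', fwdDiff, ih, ih, Finset.prod_range_succ]
    have h1 : b + (y + 1) + l = b + y + l + 1 := by ring
    have h2 : b + y + (l + 1) = b + y + l + 1 := by ring
    rw [h1, h2, ← add_assoc, Nat.factorial_succ, Nat.factorial_succ (b + y + l)]
    have h3 : ((b + y + l)! : ℂ) ≠ 0 := by exact_mod_cast Nat.factorial_ne_zero _
    have h4 : (b + y + l + 1 : ℂ) ≠ 0 := by exact_mod_cast Nat.succ_ne_zero (b + y + l)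
    push_cast
    field_simp
    ring

/-- A terminating hypergeometric sum of Chu–Vandermonde type. -/
theorem sum_factorial_alternating (m n l : ℕ) (hl : l ≤ n) :
    ∑ k ∈ Finset.range (l + 1), ((n - k)! : ℂ) / (k ! : ℂ)
        * ((-1) ^ (l - k) / (((l - k)! : ℂ) * ((m + (l - k))! : ℂ)))
      = ((n - l)! : ℂ) / (((m + l)! : ℂ) * (l ! : ℂ))
        * ∏ i ∈ Finset.range l, ((m : ℂ) - n + l + i) := by
  have h := fwdDiff_iter_factorial_div (n - l) m l 0
  rw [fwdDiff_iter_eq_sum_shift] at h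
  have hc : ((n - l : ℕ) : ℂ) = n - l := by push_cast [hl]; ring
  have hl0 : (l ! : ℂ) ≠ 0 := by exact_mod_cast Nat.factorial_ne_zero _
  have hs : ∑ k ∈ Finset.range (l + 1), ((n - k)! : ℂ) / (k ! : ℂ)
        * ((-1) ^ (l - k) / (((l - k)! : ℂ) * ((m + (l - k))! : ℂ)))
      = (-1) ^ l / (l ! : ℂ) * ∑ k ∈ Finset.range (l + 1), ((-1 : ℤ) ^ (l - k) * (l.choose k : ℤ)) •
        (((n - l + (0 + k • 1))! : ℂ) / ((m + (0 + k • 1))! : ℂ)) := by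
    -- Reversing k to l - k turns the sum into the binomial expansion of the l-th difference at 0,
    -- up to (-1)^l / l!.
    rw [← Finset.sum_flip, Finset.mul_sum]
    refine Finset.sum_congr rfl fun k hk => ?_
    have hk' : k ≤ l := by simpa [Nat.lt_succ_iff] using hk
    have e1 : n - (l - k) = n - l + k := by omega
    have e2 : l - (l - k) = k := by omega
    rw [e1, e2, zsmul_eq_mul]
    push_cast
    rw [Nat.cast_choose ℂ hk']
    have e3 : (-1 : ℂ) ^ l * (-1) ^ (l - k) = (-1) ^ k := by
      rw [← pow_add, show l + (l - k) = 2 * (l - k) + k by omega, pow_add, pow_mul]; simp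
    simp only [smul_eq_mul, mul_one, zero_add]
    rw [← e3]
    field_simp
  rw [hs, h, hc]
  have e4 : ((-1 : ℂ) ^ l) * (-1) ^ l = 1 := by rw [← mul_pow]; simp
  simp only [add_zero]
  have e5 : (m : ℂ) - (n - l) = m - n + l := by ring
  rw [e5]
  linear_combination ((n - l)! : ℂ) / (((m + l)! : ℂ) * (l ! : ℂ))
    * (∏ i ∈ Finset.range l, ((m : ℂ) - n + l + i)) * e4

theorem sum_factorial_alternating_of_le (m n l : ℕ) (h : l + m ≤ n) :
    ∑ k ∈ Finset.range (l + 1), ((n - k)! : ℂ) / (k ! : ℂ)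
        * ((-1) ^ (l - k) / (((l - k)! : ℂ) * ((m + (l - k))! : ℂ)))
      = (-1) ^ l * ((n - m - l).choose l : ℂ) * ((n - l)! : ℂ) / ((m + l)! : ℂ) := by
  rw [sum_factorial_alternating m n l (by omega)]
  have hl0 : (l ! : ℂ) ≠ 0 := by exact_mod_cast Nat.factorial_ne_zero _
  have hp : ∏ i ∈ Finset.range l, ((m : ℂ) - n + l + i)
      = (-1) ^ l * ((l ! : ℂ) * ((n - m - l).choose l : ℂ)) := by
    have h1 : ((l ! : ℂ) * ((n - m - l).choose l : ℂ)) = ((n - m - l).descFactorial l : ℂ) := by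
      rw [Nat.descFactorial_eq_factorial_mul_choose]; push_cast; rfl
    obtain ⟨d, rfl⟩ := Nat.exists_eq_add_of_le h
    have h2 : l + m + d - m - l = d := by omega
    rw [h1, h2, Nat.descFactorial_eq_prod_range]
    by_cases hd : l ≤ d
    · push_cast
      rw [← Finset.card_range l, ← Finset.prod_const, Finset.card_range, ← Finset.prod_mul_distrib]
      refine Finset.prod_congr rfl fun i hi => ?_
      rw [Nat.cast_sub (by have := Finset.mem_range.1 hi; omega)]
      ring
    -- If d < l, both products contain the zero factor i = d.
    · rw [Finset.prod_eq_zero (Finset.mem_range.2 (not_le.1 hd)) (by push_cast; ring),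
        Finset.prod_eq_zero (Finset.mem_range.2 (not_le.1 hd)) (Nat.sub_self d)]
      simp
  rw [hp]
  field_simp

/-- Past l = n - m the factors of the product are the positive integers s+1, …, s+l. -/
theorem sum_factorial_alternating_of_lt (m n s : ℕ) (hmn : m ≤ n) (hs : s < m) :
    ∑ k ∈ Finset.range (n - m + s + 1 + 1), ((n - k)! : ℂ) / (k ! : ℂ)
        * ((-1) ^ (n - m + s + 1 - k)
          / (((n - m + s + 1 - k)! : ℂ) * ((m + (n - m + s + 1 - k))! : ℂ)))
      = (((m - s - 1)! : ℂ) * ((n - m + 2 * s + 1)! : ℂ))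
          / ((s ! : ℂ) * ((n + s + 1)! : ℂ) * ((n - m + s + 1)! : ℂ)) := by
  rw [sum_factorial_alternating m n _ (by omega)]
  have e1 : n - (n - m + s + 1) = m - s - 1 := by omega
  have e2 : m + (n - m + s + 1) = n + s + 1 := by omega
  have hs0 : (s ! : ℂ) ≠ 0 := by exact_mod_cast Nat.factorial_ne_zero _
  have hp : ∏ i ∈ Finset.range (n - m + s + 1), ((m : ℂ) - n + (n - m + s + 1 : ℕ) + i)
      = ((n - m + 2 * s + 1)! : ℂ) / (s ! : ℂ) := by
    rw [eq_div_iff hs0, mul_comm, show n - m + 2 * s + 1 = s + (n - m + s + 1) by omega,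
      ← Nat.factorial_mul_ascFactorial, Nat.ascFactorial_eq_prod_range]
    push_cast [hmn]
    congr 1
    exact Finset.prod_congr rfl fun i _ => by ring
  rw [e1, e2, hp]
  field_simp

/-! ### Nested sums and 𝔉 for x_k = w/(m+k) -/

theorem nestedSum_eq_zero {x : ℕ → ℂ} {N : ℕ} (hx : ∀ i, N ≤ i → x i = 0) (r j : ℕ)
    (h : N ≤ j + 1) : nestedSum x (r + 1) j = 0 := by
  rw [nestedSum]
  exact (tsum_congr fun i => by rw [hx (j + i + 1) (by omega)]; ring).trans tsum_zero

theorem nestedSum_succ {x : ℕ → ℂ} {N : ℕ} (hx : ∀ i, N ≤ i → x i = 0) (r j : ℕ) :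
    nestedSum x (r + 1) j
      = x j * x (j + 1) * nestedSum x r (j + 2) + nestedSum x (r + 1) (j + 1) := by
  have hs : Summable fun i : ℕ => x (j + i) * x (j + i + 1) * nestedSum x r (j + i + 2) := by
    refine summable_of_ne_finset_zero (s := Finset.range N) fun i hi => ?_
    rw [hx (j + i) (by simp at hi; omega)]; ring
  rw [nestedSum, hs.tsum_eq_zero_add, nestedSum]
  simp only [add_zero]
  congr 1
  refine tsum_congr fun i => ?_
  rw [show j + (i + 1) = j + 1 + i by ring]

/-- Induction on r and, inside it, on N - j: the closed form satisfies the recursion that splits off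
k₁ = j. The bound `r ≤ m + N` keeps the subtraction in (m+N-r)! genuine. -/
theorem nestedSum_arith {x : ℕ → ℂ} {N m : ℕ} {w : ℂ} (hx : ∀ i, N ≤ i → x i = 0)
    (hx' : ∀ i < N, x i = w / ((m : ℂ) + 1 + i)) (r : ℕ) : ∀ j ≤ N, r ≤ m + N →
    nestedSum x r j = w ^ (2 * r) * ((N - j - r).choose r : ℂ)
      * (((m + N - r)! : ℂ) * ((m + j)! : ℂ)) / (((m + N)! : ℂ) * ((m + j + r)! : ℂ)) := by
  have hf : ∀ k : ℕ, (k ! : ℂ) ≠ 0 := fun k => by exact_mod_cast Nat.factorial_ne_zero k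
  induction r with
  | zero =>
    intro j _ _
    have := hf (m + N); have := hf (m + j)
    simp [nestedSum]
    field_simp
  | succ r ih =>
    intro j hj hr
    induction hd : N - j using Nat.strong_induction_on generalizing j with
    | _ d ihd =>
    by_cases h1 : N ≤ j + 1
    · rw [nestedSum_eq_zero hx _ _ h1, Nat.choose_eq_zero_of_lt (by omega)]
      simp
    obtain ⟨e, rfl⟩ : ∃ e, N = j + e + 2 := ⟨N - j - 2, by omega⟩
    rw [nestedSum_succ hx, hx' j (by omega), hx' (j + 1) (by omega), ih (j + 2) (by omega) (by omega),
      ihd (j + e + 2 - (j + 1)) (by omega) (j + 1) (by omega) rfl, ← hd]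
    obtain ⟨q, hq⟩ : ∃ q, m + (j + e + 2) = q + r + 1 := ⟨m + (j + e + 2) - r - 1, by omega⟩
    have a1 : m + (j + e + 2) - r = q + 1 := by omega
    have a2 : m + (j + e + 2) - (r + 1) = q := by omega
    have a3 : j + e + 2 - (j + 2) - r = e - r := by omega
    have a4 : j + e + 2 - (j + 1) - (r + 1) = e - r := by omega
    have a5 : j + e + 2 - j - (r + 1) = e + 1 - r := by omega
    have b1 : m + (j + 2) = m + j + 1 + 1 := by ring
    have b2 : m + j + 1 + 1 + r = m + j + r + 1 + 1 := by ring
    have b3 : m + (j + 1) = m + j + 1 := by ring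
    have b4 : m + j + 1 + (r + 1) = m + j + r + 1 + 1 := by ring
    have b5 : m + j + (r + 1) = m + j + r + 1 := by ring
    rw [a1, a2, a3, a4, a5, b1, b2, b3, b4, b5]
    simp only [Nat.factorial_succ]
    have c1 : (m + j + 1 : ℂ) ≠ 0 := by exact_mod_cast Nat.succ_ne_zero (m + j)
    have c1' : (m + 1 + j : ℂ) ≠ 0 := by rw [add_right_comm]; exact c1
    have c2 : (m + j + 1 + 1 : ℂ) ≠ 0 := by
      simpa using Nat.cast_ne_zero (R := ℂ).2 (Nat.succ_ne_zero (m + j + 1))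
    have c2' : (m + 1 + (j + 1) : ℂ) ≠ 0 := by
      rw [← add_assoc, add_right_comm (m : ℂ)]; exact c2
    have c3 : (m + j + r + 1 : ℂ) ≠ 0 := by exact_mod_cast Nat.succ_ne_zero (m + j + r)
    have c4 : (m + j + r + 1 + 1 : ℂ) ≠ 0 := by
      simpa using Nat.cast_ne_zero (R := ℂ).2 (Nat.succ_ne_zero (m + j + r + 1))
    have c5 := hf (m + j); have c6 := hf (m + (j + e + 2)); have c7 := hf (m + j + r)
    by_cases her : r ≤ e
    · obtain ⟨t, rfl⟩ := Nat.exists_eq_add_of_le her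
      have d1 : r + t + 1 - r = t + 1 := by omega
      have d2 : r + t - r = t := by omega
      have d3 : ((t + 1).choose (r + 1) : ℂ) = t.choose r + t.choose (r + 1) := by
        exact_mod_cast Nat.choose_succ_succ t r
      -- With Pascal's rule `d3`, this ratio of neighbouring binomials reduces the recursion to a
      -- polynomial identity.
      have d4 : (t.choose (r + 1) : ℂ) * (r + 1) = t.choose r * (t - r) := by
        by_cases htr : r ≤ t
        · have := Nat.choose_succ_right_eq t r
          rw [← Nat.cast_sub htr]; exact_mod_cast this
        · rw [Nat.choose_eq_zero_of_lt (by omega), Nat.choose_eq_zero_of_lt (by omega)]; simp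
      have hqc : (q : ℂ) = m + j + t + 1 := by
        have : q = m + j + t + 1 := by omega
        rw [this]; push_cast; ring
      rw [d1, d2, d3]
      push_cast
      rw [hqc]
      field_simp
      linear_combination -((q ! : ℂ) * w ^ (2 * r + 2) * (m + j + 1) * (m + j + 2)) * d4
    · have d1 : e + 1 - r = 0 := by omega
      have d2 : e - r = 0 := by omega
      have : 0 < r := by omega
      rw [d1, d2, Nat.choose_eq_zero_of_lt this, Nat.choose_eq_zero_of_lt (by omega)]
      simp

theorem frakFFin_arith (N m : ℕ) (w : ℂ) :
    frakFFin (fun k : Fin N => w / ((m : ℂ) + 1 + ((k : ℕ) : ℂ)))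
      = ∑ l ∈ Finset.range (N + 1), (-1) ^ l * (w ^ (2 * l) * ((N - l).choose l : ℂ)
        * (((m + N - l)! : ℂ) * (m ! : ℂ)) / (((m + N)! : ℂ) * ((m + l)! : ℂ))) := by
  set x : ℕ → ℂ := fun i => if h : i < N then w / ((m : ℂ) + 1 + i) else 0 with hxdef
  have hx : ∀ i, N ≤ i → x i = 0 := fun i hi => by simp [hxdef, not_lt.2 hi]
  have hx' : ∀ i < N, x i = w / ((m : ℂ) + 1 + i) := fun i hi => by simp [hxdef, hi]
  have hz : ∀ r j, N ≤ r + j → nestedSum x (r + 1) j = 0 := by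
    intro r
    induction r with
    | zero => intro j hj; exact nestedSum_eq_zero hx 0 j (by omega)
    | succ r ih =>
      intro j hj
      rw [nestedSum]
      exact (tsum_congr fun i => by rw [ih _ (by omega)]; ring).trans tsum_zero
  have h1 : frakFFin (fun k : Fin N => w / ((m : ℂ) + 1 + ((k : ℕ) : ℂ))) = frakF x := rfl
  rw [h1, frakF, tsum_eq_sum (s := Finset.range N)
    (fun r hr => by rw [hz r 0 (by simpa using hr)]; ring), Finset.sum_range_succ', add_comm]
  congr 1
  · refine Finset.sum_congr rfl fun r hr => ?_
    have := Finset.mem_range.1 hr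
    rw [nestedSum_arith hx hx' (r + 1) 0 (by omega) (by omega)]
    simp
  · have hf : ∀ k : ℕ, (k ! : ℂ) ≠ 0 := fun k => by exact_mod_cast Nat.factorial_ne_zero k
    have := hf (m + N); have := hf m
    simp
    field_simp

/-! ### Values, derivatives and bounds of 1/Γ -/

/-- The entire function `1 / Γ`. -/
noncomputable def invGamma (s : ℂ) : ℂ := (Complex.Gamma s)⁻¹

theorem differentiable_invGamma : Differentiable ℂ invGamma :=
  Complex.differentiable_one_div_Gamma

theorem invGamma_eq_mul (s : ℂ) : invGamma s = s * invGamma (s + 1) :=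
  Complex.one_div_Gamma_eq_self_mul_one_div_Gamma_add_one s

theorem invGamma_neg_nat (p : ℕ) : invGamma (-p) = 0 := by
  rw [invGamma, Complex.Gamma_neg_nat_eq_zero, inv_zero]

theorem invGamma_nat_add_one (p : ℕ) : invGamma (p + 1) = ((p ! : ℂ))⁻¹ := by
  rw [invGamma, Complex.Gamma_nat_eq_factorial]

theorem deriv_invGamma_eq (s : ℂ) :
    deriv invGamma s = invGamma (s + 1) + s * deriv invGamma (s + 1) := by
  have h1 : HasDerivAt (fun s => invGamma (s + 1)) (deriv invGamma (s + 1)) s :=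
    (differentiable_invGamma (s + 1)).hasDerivAt.comp_add_const s 1
  have h2 : HasDerivAt (fun s => s * invGamma (s + 1))
      (1 * invGamma (s + 1) + s * deriv invGamma (s + 1)) s := (hasDerivAt_id s).mul h1
  rw [← funext invGamma_eq_mul, one_mul] at h2
  exact h2.deriv

theorem deriv_invGamma_neg_nat (p : ℕ) : deriv invGamma (-p) = (-1) ^ p * (p ! : ℂ) := by
  induction p with
  | zero =>
    rw [deriv_invGamma_eq]
    simp [invGamma]
  | succ p ih =>
    have h : (-((p + 1 : ℕ) : ℂ)) + 1 = -p := by push_cast; ring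
    rw [deriv_invGamma_eq, h, ih, invGamma_neg_nat, Nat.factorial_succ]
    push_cast
    ring

/-- Compactness covers k ≤ K. Beyond that, 1/Γ(s) = s/Γ(s+1) with |s| ≥ 1 makes the norms
nonincreasing in k. -/
theorem exists_norm_invGamma_le (R : ℝ) :
    ∃ C : ℝ, ∀ ν : ℂ, ‖ν‖ ≤ R → ∀ k : ℕ, ‖invGamma (ν + k + 1)‖ ≤ C := by
  obtain ⟨K, hK⟩ := exists_nat_ge R
  obtain ⟨C, hC⟩ := (isCompact_closedBall (0 : ℂ) (R + K + 1)).exists_bound_of_continuousOn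
    differentiable_invGamma.continuous.continuousOn
  refine ⟨C, fun ν hν k => ?_⟩
  rcases le_total k K with hk | hk
  · refine hC _ (mem_closedBall_zero_iff.2 ?_)
    have h1 := norm_add_le (ν + k) 1
    have h2 := norm_add_le ν (k : ℂ)
    have h3 : (k : ℝ) ≤ K := by exact_mod_cast hk
    simp at h1 h2
    linarith
  · induction k, hk using Nat.le_induction with
    | base =>
      refine hC _ (mem_closedBall_zero_iff.2 ?_)
      have h1 := norm_add_le (ν + K) 1
      have h2 := norm_add_le ν (K : ℂ)
      simp at h1 h2
      linarith
    | succ k hk ih =>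
      refine le_trans ?_ ih
      rw [invGamma_eq_mul (ν + k + 1), norm_mul, Nat.cast_succ, ← add_assoc]
      refine le_mul_of_one_le_left (norm_nonneg _) ?_
      have h1 : ‖((k + 1 : ℕ) : ℂ)‖ ≤ ‖ν + k + 1‖ + ‖ν‖ := by
        have := norm_sub_le (ν + k + 1) ν
        rwa [show ν + k + 1 - ν = ((k + 1 : ℕ) : ℂ) by push_cast; ring] at this
      rw [Complex.norm_natCast] at h1
      have h3 : (K : ℝ) ≤ k := by exact_mod_cast hk
      push_cast at h1
      linarith

/-- Cauchy's estimate on unit circles, using the bound uniform over the ball of radius ‖ν‖ + 1. -/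
theorem exists_norm_deriv_invGamma_le (ν : ℂ) :
    ∃ C : ℝ, ∀ k : ℕ, ‖deriv invGamma (ν + k + 1)‖ ≤ C := by
  obtain ⟨C, hC⟩ := exists_norm_invGamma_le (‖ν‖ + 1)
  refine ⟨C, fun k => ?_⟩
  have h := Complex.norm_deriv_le_of_forall_mem_sphere_norm_le (c := ν + k + 1) (C := C)
    one_pos differentiable_invGamma.diffContOnCl fun z hz => ?_
  · simpa using h
  · have h1 : ‖z - (ν + k + 1)‖ = 1 := by simpa [dist_eq_norm] using hz
    have h2 := hC (z - k - 1) ?_ k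
    · rwa [show z - k - 1 + k + 1 = z by ring] at h2
    · have := norm_add_le (z - (ν + k + 1)) ν
      rw [h1, show z - (ν + k + 1) + ν = z - k - 1 by ring] at this
      linarith

/-! ### Bessel series and differentiation in the order -/

/-- The power series `∑ (-1)^k a_k w^(2k) / k!`. -/
noncomputable def evenSeries (a : ℕ → ℂ) (w : ℂ) : ℂ :=
  ∑' k : ℕ, (-1) ^ k * w ^ (2 * k) / (k ! : ℂ) * a k

theorem norm_evenSeries_term_le {a : ℕ → ℂ} {C : ℝ} (ha : ∀ k, ‖a k‖ ≤ C) (w : ℂ) (k : ℕ) :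
    ‖(-1) ^ k * w ^ (2 * k) / (k ! : ℂ) * a k‖ ≤ (‖w‖ ^ 2) ^ k / (k ! : ℝ) * C := by
  rw [norm_mul, norm_div, norm_mul, norm_pow, norm_neg, norm_one, one_pow, one_mul, norm_pow,
    Complex.norm_natCast, pow_mul]
  exact mul_le_mul_of_nonneg_left (ha k) (by positivity)

theorem summable_evenSeries_bound (C : ℝ) (w : ℂ) :
    Summable fun k : ℕ => (‖w‖ ^ 2) ^ k / (k ! : ℝ) * C :=
  (Real.summable_pow_div_factorial _).mul_right C

theorem summable_evenSeries {a : ℕ → ℂ} {C : ℝ} (ha : ∀ k, ‖a k‖ ≤ C) (w : ℂ) :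
    Summable fun k : ℕ => (-1) ^ k * w ^ (2 * k) / (k ! : ℂ) * a k :=
  .of_norm_bounded (summable_evenSeries_bound C w) (norm_evenSeries_term_le ha w)

theorem evenSeries_sub_isBigO {a : ℕ → ℂ} {C : ℝ} (ha : ∀ k, ‖a k‖ ≤ C) (K : ℕ) :
    (fun w => evenSeries a w
      - ∑ k ∈ Finset.range K, (-1) ^ k * w ^ (2 * k) / (k ! : ℂ) * a k)
      =O[𝓝 0] fun w : ℂ => w ^ (2 * K) := by
  have hC : 0 ≤ C := (norm_nonneg _).trans (ha 0)
  refine IsBigO.of_bound (∑' k : ℕ, (1 : ℝ) ^ k / (k ! : ℝ) * C) ?_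
  filter_upwards [Metric.ball_mem_nhds (0 : ℂ) one_pos] with w hw
  have hw1 : ‖w‖ < 1 := by simpa using hw
  rw [evenSeries, ← (summable_evenSeries ha w).sum_add_tsum_nat_add K, add_sub_cancel_left,
    ← tsum_mul_right]
  refine tsum_of_norm_bounded
    ((((Real.summable_pow_div_factorial 1).mul_right C).mul_right _).hasSum) fun k => ?_
  refine (norm_evenSeries_term_le ha w (k + K)).trans ?_
  have h1 : (‖w‖ ^ 2) ^ (k + K) ≤ ‖w ^ (2 * K)‖ := by
    rw [pow_add, norm_pow, pow_mul]
    exact mul_le_of_le_one_left (by positivity)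
      (pow_le_one₀ (by positivity) (pow_le_one₀ (norm_nonneg _) hw1.le))
  have h2 : (k ! : ℝ) ≤ ((k + K)! : ℝ) := by
    exact_mod_cast Nat.factorial_le (Nat.le_add_right k K)
  have h3 : (0 : ℝ) < (k ! : ℝ) := by exact_mod_cast Nat.factorial_pos k
  calc (‖w‖ ^ 2) ^ (k + K) / ((k + K)! : ℝ) * C ≤ ‖w ^ (2 * K)‖ / (k ! : ℝ) * C := by gcongr
    _ = _ := by rw [one_pow]; ring

theorem evenSeries_isBigO_one {a : ℕ → ℂ} {C : ℝ} (ha : ∀ k, ‖a k‖ ≤ C) :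
    evenSeries a =O[𝓝 0] fun _ : ℂ => (1 : ℂ) := by
  simpa using evenSeries_sub_isBigO ha 0

theorem besselJ_two_mul (ν w : ℂ) :
    besselJ ν (2 * w) = w ^ ν * evenSeries (fun k => invGamma (ν + k + 1)) w := by
  rw [besselJ, evenSeries, mul_div_cancel_left₀ _ two_ne_zero]
  congr 1
  refine tsum_congr fun k => ?_
  rw [invGamma, mul_inv]
  ring

/-- Termwise differentiation by Weierstrass: the terms are holomorphic in μ and dominated on a ball
by a summable sequence. -/
theorem hasDerivAt_evenSeries_invGamma (ν w : ℂ) :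
    HasDerivAt (fun μ : ℂ => evenSeries (fun k => invGamma (μ + k + 1)) w)
      (evenSeries (fun k => deriv invGamma (ν + k + 1)) w) ν := by
  obtain ⟨C, hC⟩ := exists_norm_invGamma_le (‖ν‖ + 1)
  have hν : ν ∈ Metric.ball (0 : ℂ) (‖ν‖ + 1) := by simp
  have hd : ∀ (k : ℕ) (μ : ℂ),
      HasDerivAt (fun μ : ℂ => (-1) ^ k * w ^ (2 * k) / (k ! : ℂ) * invGamma (μ + k + 1))
        ((-1) ^ k * w ^ (2 * k) / (k ! : ℂ) * deriv invGamma (μ + k + 1)) μ := by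
    intro k μ
    have h := (differentiable_invGamma (μ + (k + 1))).hasDerivAt.comp_add_const μ (k + 1 : ℂ)
    simp only [← add_assoc] at h
    exact h.const_mul _
  have hle : ∀ (k : ℕ) (μ : ℂ), μ ∈ Metric.ball (0 : ℂ) (‖ν‖ + 1) →
      ‖(-1) ^ k * w ^ (2 * k) / (k ! : ℂ) * invGamma (μ + k + 1)‖
        ≤ (‖w‖ ^ 2) ^ k / (k ! : ℝ) * C := fun k μ hμ =>
    norm_evenSeries_term_le (fun k => hC μ (mem_ball_zero_iff.1 hμ).le k) w k
  have hdiff : ∀ k : ℕ, DifferentiableOn ℂ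
      (fun μ : ℂ => (-1) ^ k * w ^ (2 * k) / (k ! : ℂ) * invGamma (μ + k + 1))
      (Metric.ball (0 : ℂ) (‖ν‖ + 1)) :=
    fun k μ _ => (hd k μ).differentiableAt.differentiableWithinAt
  have h1 := Complex.hasSum_deriv_of_summable_norm (summable_evenSeries_bound C w) hdiff
    Metric.isOpen_ball hle hν
  have h2 := (Complex.differentiableOn_tsum_of_summable_norm (summable_evenSeries_bound C w) hdiff
    Metric.isOpen_ball hle).differentiableAt (Metric.isOpen_ball.mem_nhds hν)
  have h3 := h2.hasDerivAt
  rw [← h1.tsum_eq, tsum_congr fun k => (hd k ν).deriv] at h3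
  exact h3

/-- The derivative `∂J_ν(2w)/∂ν`. -/
noncomputable def besselJOrderDeriv (ν w : ℂ) : ℂ :=
  w ^ ν * (Complex.log w * evenSeries (fun k => invGamma (ν + k + 1)) w
    + evenSeries (fun k => deriv invGamma (ν + k + 1)) w)

theorem hasDerivAt_besselJ_order (ν : ℂ) {w : ℂ} (hw : w ≠ 0) :
    HasDerivAt (fun μ => besselJ μ (2 * w)) (besselJOrderDeriv ν w) ν := by
  have h1 : HasDerivAt (fun μ : ℂ => w ^ μ) (w ^ ν * Complex.log w) ν := by
    simpa using (hasDerivAt_id ν).const_cpow (c := w) (Or.inl hw)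
  have h := h1.mul (hasDerivAt_evenSeries_invGamma ν w)
  simp only [besselJ_two_mul]
  refine h.congr_deriv ?_
  rw [besselJOrderDeriv]
  ring

/-! ### The function Y at integer order -/

theorem besselJ_neg_nat (N : ℕ) {w : ℂ} (hw : w ≠ 0) :
    besselJ (-N) (2 * w) = (-1) ^ N * besselJ N (2 * w) := by
  obtain ⟨C, hC⟩ := exists_norm_invGamma_le ‖(-N : ℂ)‖
  have hs := summable_evenSeries (fun k => hC (-N) le_rfl k) w
  rw [besselJ_two_mul, besselJ_two_mul, evenSeries, ← hs.sum_add_tsum_nat_add N,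
    Finset.sum_eq_zero, zero_add, evenSeries, Complex.cpow_neg, Complex.cpow_natCast,
    ← tsum_mul_left, ← tsum_mul_left, ← tsum_mul_left]
  · refine tsum_congr fun k => ?_
    have h1 : (-N : ℂ) + (k + N : ℕ) + 1 = k + 1 := by push_cast; ring
    have h2 : (N : ℂ) + k + 1 = (k + N : ℕ) + 1 := by push_cast; ring
    rw [h1, h2, invGamma_nat_add_one, invGamma_nat_add_one]
    field_simp
    ring
  · intro k hk
    obtain ⟨d, rfl⟩ : ∃ d, N = k + d + 1 := ⟨N - k - 1, by have := Finset.mem_range.1 hk; omega⟩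
    rw [show (-((k + d + 1 : ℕ) : ℂ) + k + 1) = -(d : ℂ) by push_cast; ring, invGamma_neg_nat,
      mul_zero]

theorem tendsto_besselYQuot_nat (N : ℕ) {w : ℂ} (hw : w ≠ 0) :
    Tendsto (fun μ => besselYQuot μ (2 * w)) (𝓝[≠] (N : ℂ))
      (𝓝 ((besselJOrderDeriv N w + (-1) ^ N * besselJOrderDeriv (-N) w) / Real.pi)) := by
  have hpi : (Real.pi : ℂ) ≠ 0 := by exact_mod_cast Real.pi_ne_zero
  have hcos : Complex.cos (Real.pi * N) = (-1) ^ N := by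
    rw [mul_comm]
    exact_mod_cast congrArg Complex.ofReal (Real.cos_nat_mul_pi N)
  have hsin : Complex.sin (Real.pi * N) = 0 := by
    rw [mul_comm, Complex.sin_nat_mul_pi]
  have hlin : HasDerivAt (fun μ : ℂ => (Real.pi : ℂ) * μ) Real.pi N := by
    simpa using (hasDerivAt_id (N : ℂ)).const_mul (Real.pi : ℂ)
  have hden : HasDerivAt (fun μ : ℂ => Complex.sin (Real.pi * μ)) ((-1) ^ N * Real.pi) N := by
    simpa [hcos] using hlin.csin
  have hc : HasDerivAt (fun μ : ℂ => Complex.cos (Real.pi * μ)) 0 N := by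
    simpa [hsin] using hlin.ccos
  have hJ := (hasDerivAt_besselJ_order (N : ℂ) hw).mul hc
  have hJneg : HasDerivAt (fun μ : ℂ => besselJ (-μ) (2 * w)) (besselJOrderDeriv (-N) w * -1) N :=
    (hasDerivAt_besselJ_order (-N : ℂ) hw).comp (N : ℂ) (hasDerivAt_neg (N : ℂ))
  have hnum := hJ.sub hJneg
  have hnum0 : besselJ N (2 * w) * Complex.cos (Real.pi * N) - besselJ (-N) (2 * w) = 0 := by
    rw [hcos, besselJ_neg_nat N hw]; ring
  have hne : ((-1 : ℂ) ^ N * Real.pi) ≠ 0 := mul_ne_zero (pow_ne_zero _ (by norm_num)) hpi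
  -- L'Hôpital: numerator and denominator vanish at N, so the quotient is a ratio of slopes.
  have hlim := (hasDerivAt_iff_tendsto_slope.1 hnum).div (hasDerivAt_iff_tendsto_slope.1 hden) hne
  have hval : (besselJOrderDeriv N w * Complex.cos (Real.pi * N) + besselJ N (2 * w) * 0
      - besselJOrderDeriv (-N) w * -1) / ((-1) ^ N * Real.pi)
      = (besselJOrderDeriv N w + (-1) ^ N * besselJOrderDeriv (-N) w) / Real.pi := by
    rw [hcos]
    have h1 : ((-1 : ℂ) ^ N) * (-1) ^ N = 1 := by rw [← mul_pow]; simp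
    rw [div_eq_div_iff hne hpi]
    linear_combination (-besselJOrderDeriv (-N) w * Real.pi) * h1
  rw [hval] at hlim
  refine hlim.congr' ?_
  filter_upwards [self_mem_nhdsWithin] with μ hμ
  have hμ' : μ - N ≠ 0 := sub_ne_zero.2 hμ
  simp only [Pi.div_apply, slope_def_field, Pi.sub_apply, Pi.mul_apply]
  rw [hnum0, hsin, sub_zero, sub_zero, div_div_div_cancel_right₀ hμ', besselYQuot]

theorem pi_mul_besselY_nat (N : ℕ) {w : ℂ} (hw : w ≠ 0) :
    Real.pi * besselY N (2 * w) = besselJOrderDeriv N w + (-1) ^ N * besselJOrderDeriv (-N) w := by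
  have hpi : (Real.pi : ℂ) ≠ 0 := by exact_mod_cast Real.pi_ne_zero
  rw [besselY, if_pos ⟨(N : ℤ), by simp⟩, (tendsto_besselYQuot_nat N hw).limUnder_eq,
    mul_div_cancel₀ _ hpi]

/-! ### Asymptotics at the origin -/

theorem one_isBigO_log : (fun _ : ℂ => (1 : ℂ)) =O[𝓝[≠] 0] Complex.log := by
  have h : Tendsto (fun w : ℂ => Real.log ‖w‖) (𝓝[≠] 0) atBot :=
    Real.tendsto_log_nhdsGT_zero.comp tendsto_norm_nhdsNE_zero
  refine IsBigO.of_bound 1 ?_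
  filter_upwards [h.eventually_le_atBot (-1)] with w hw
  rw [norm_one, one_mul]
  have h1 := Complex.abs_re_le_norm (Complex.log w)
  rw [Complex.log_re] at h1
  exact le_trans (by rw [le_abs]; right; linarith) h1

theorem pi_mul_besselY_isBigO (n : ℕ) :
    (fun w : ℂ => Real.pi * besselY ((n : ℂ) + 1) (2 * w)
      + ∑ k ∈ Finset.range (n + 1), ((n - k)! : ℂ) / (k ! : ℂ) * w ^ (2 * k) * (w ^ (n + 1))⁻¹)
      =O[𝓝[≠] 0] fun w : ℂ => w ^ (n + 1) * Complex.log w := by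
  have hpw : ∀ f : ℂ → ℂ, f =O[𝓝[≠] 0] (fun w : ℂ => w ^ (2 * (n + 1))) →
      (fun w : ℂ => (w ^ (n + 1))⁻¹ * f w) =O[𝓝[≠] 0] fun w : ℂ => w ^ (n + 1) := by
    intro f hf
    refine ((isBigO_refl (fun w : ℂ => (w ^ (n + 1))⁻¹) (𝓝[≠] 0)).mul hf).congr'
      EventuallyEq.rfl ?_
    filter_upwards [self_mem_nhdsWithin] with w hw
    have : w ≠ 0 := hw
    field_simp
    ring
  set N : ℂ := ((n + 1 : ℕ) : ℂ) with hN
  obtain ⟨C₁, hC₁⟩ := exists_norm_invGamma_le ‖N‖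
  obtain ⟨C₂, hC₂⟩ := exists_norm_deriv_invGamma_le N
  obtain ⟨C₃, hC₃⟩ := exists_norm_invGamma_le ‖-N‖
  obtain ⟨C₄, hC₄⟩ := exists_norm_deriv_invGamma_le (-N)
  have hz : ∀ k < n + 1, -N + k + 1 = -((n - k : ℕ) : ℂ) := fun k hk => by
    rw [hN, Nat.cast_sub (by omega)]; push_cast; ring
  have b1 := (evenSeries_isBigO_one (fun k => hC₁ N le_rfl k)).mono
    (nhdsWithin_le_nhds (s := {0}ᶜ))
  have b2 := (evenSeries_isBigO_one hC₂).mono (nhdsWithin_le_nhds (s := {0}ᶜ))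
  have b3 := (evenSeries_sub_isBigO (fun k => hC₃ (-N) le_rfl k) (n + 1)).mono
    (nhdsWithin_le_nhds (s := {0}ᶜ))
  have b4 := (evenSeries_sub_isBigO hC₄ (n + 1)).mono (nhdsWithin_le_nhds (s := {0}ᶜ))
  have hrefl := isBigO_refl (fun w : ℂ => w ^ (n + 1)) (𝓝[≠] 0)
  have hlog := isBigO_refl Complex.log (𝓝[≠] 0)
  have t1 := hrefl.mul (hlog.mul b1)
  have t2 := hrefl.mul (b2.trans one_isBigO_log)
  have t3 := ((hpw _ b3).mul hlog).const_mul_left ((-1) ^ (n + 1))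
  have t4 := ((hpw _ b4).mul one_isBigO_log).const_mul_left ((-1) ^ (n + 1))
  simp only [mul_one] at t1
  refine (((t1.add t2).add t3).add t4).congr' ?_ EventuallyEq.rfl
  filter_upwards [self_mem_nhdsWithin] with w hw
  have hY := pi_mul_besselY_nat (n + 1) (w := w) hw
  have hN' : (n : ℂ) + 1 = N := by rw [hN]; push_cast; rfl
  -- At order -(n+1) the first n+1 values of 1/Γ vanish, so no logarithm enters below w^(n+1); their
  -- derivatives give the finite sum `z4`.
  have z3 : ∑ k ∈ Finset.range (n + 1),
      (-1) ^ k * w ^ (2 * k) / (k ! : ℂ) * invGamma (-N + k + 1) = 0 :=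
    Finset.sum_eq_zero fun k hk => by
      rw [hz k (Finset.mem_range.1 hk), invGamma_neg_nat, mul_zero]
  have z4 : ∑ k ∈ Finset.range (n + 1), ((n - k)! : ℂ) / (k ! : ℂ) * w ^ (2 * k) * (w ^ (n + 1))⁻¹
      = -((-1) ^ (n + 1) * (w ^ (n + 1))⁻¹ * ∑ k ∈ Finset.range (n + 1),
      (-1) ^ k * w ^ (2 * k) / (k ! : ℂ) * deriv invGamma (-N + k + 1)) := by
    rw [Finset.mul_sum, ← Finset.sum_neg_distrib]
    refine Finset.sum_congr rfl fun k hk => ?_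
    have hk' := Finset.mem_range.1 hk
    rw [hz k hk', deriv_invGamma_neg_nat]
    have e : (-1 : ℂ) ^ (n + 1) * (-1) ^ k * (-1) ^ (n - k) = -1 := by
      rw [← pow_add, ← pow_add, show n + 1 + k + (n - k) = 2 * n + 1 by omega, pow_succ, pow_mul]
      simp
    linear_combination ((((n - k)! : ℂ) / (k ! : ℂ) * w ^ (2 * k) * (w ^ (n + 1))⁻¹)) * e
  rw [hN', hN, hY, ← hN, z3, z4, besselJOrderDeriv, besselJOrderDeriv, Complex.cpow_neg, hN,
    Complex.cpow_natCast, ← hN]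
  ring

theorem pi_mul_besselJ_mul_besselY_isBigO (m n : ℕ) :
    (fun w : ℂ => (Real.pi : ℂ) * besselJ m (2 * w) * besselY ((n : ℂ) + 1) (2 * w)
      + ∑ l ∈ Finset.range (n + 1), (∑ k ∈ Finset.range (l + 1), ((n - k)! : ℂ) / (k ! : ℂ)
          * ((-1) ^ (l - k) / (((l - k)! : ℂ) * ((m + (l - k))! : ℂ))))
        * (w ^ (2 * l) * w ^ m * (w ^ (n + 1))⁻¹))
      =O[𝓝[≠] 0] fun w : ℂ => w ^ (m + n + 1) * Complex.log w := by
  obtain ⟨C, hC⟩ := exists_norm_invGamma_le ‖(m : ℂ)‖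
  have hrefl := isBigO_refl (fun w : ℂ => w ^ m) (𝓝[≠] 0)
  have b1 := hrefl.mul ((evenSeries_isBigO_one (fun k => hC m le_rfl k)).mono
    (nhdsWithin_le_nhds (s := {0}ᶜ)))
  have t1 := b1.mul (pi_mul_besselY_isBigO n)
  -- Keeping n+1-k terms of J_m against w^(2k) leaves exactly the pairs k + j ≤ n, with error
  -- O(w^(2(n+1))) before the factor w^(m-n-1).
  have t2 : ∀ k ∈ Finset.range (n + 1), (fun w : ℂ =>
      ((n - k)! : ℂ) / (k ! : ℂ) * (w ^ m * w ^ (2 * k) * (w ^ (n + 1))⁻¹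
        * (evenSeries (fun k => invGamma (m + k + 1)) w
          - ∑ j ∈ Finset.range (n + 1 - k),
            (-1) ^ j * w ^ (2 * j) / (j ! : ℂ) * invGamma (m + j + 1))))
      =O[𝓝[≠] 0] fun w : ℂ => w ^ m * 1 * (w ^ (n + 1) * Complex.log w) := by
    intro k hk
    have hk' := Finset.mem_range.1 hk
    have b2 := (evenSeries_sub_isBigO (fun k => hC m le_rfl k) (n + 1 - k)).mono
      (nhdsWithin_le_nhds (s := {0}ᶜ))
    have b3 := ((isBigO_refl (fun w : ℂ => w ^ m * w ^ (2 * k) * (w ^ (n + 1))⁻¹)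
      (𝓝[≠] 0)).mul b2).const_mul_left (((n - k)! : ℂ) / (k ! : ℂ))
    have b4 := (isBigO_refl (fun w : ℂ => w ^ m * w ^ (n + 1)) (𝓝[≠] 0)).mul one_isBigO_log
    refine (b3.trans_eventuallyEq ?_).trans (b4.congr_right fun w => by ring)
    filter_upwards [self_mem_nhdsWithin] with w hw
    have hw' : w ≠ 0 := hw
    rw [mul_one, mul_assoc, mul_assoc, mul_left_comm _ (w ^ (n + 1))⁻¹, ← pow_add,
      show 2 * k + 2 * (n + 1 - k) = (n + 1) + (n + 1) by omega, pow_add (n := n + 1),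
      inv_mul_cancel_left₀ (pow_ne_zero _ hw')]
  refine (t1.sub (IsBigO.sum t2)).congr' ?_ (Eventually.of_forall fun w => by ring)
  filter_upwards [self_mem_nhdsWithin] with w hw
  have hflip : ∑ l ∈ Finset.range (n + 1), (∑ k ∈ Finset.range (l + 1), ((n - k)! : ℂ) / (k ! : ℂ)
          * ((-1) ^ (l - k) / (((l - k)! : ℂ) * ((m + (l - k))! : ℂ))))
        * (w ^ (2 * l) * w ^ m * (w ^ (n + 1))⁻¹)
      = ∑ k ∈ Finset.range (n + 1), ((n - k)! : ℂ) / (k ! : ℂ) * (w ^ m * w ^ (2 * k)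
        * (w ^ (n + 1))⁻¹ * ∑ j ∈ Finset.range (n + 1 - k),
            (-1) ^ j * w ^ (2 * j) / (j ! : ℂ) * invGamma (m + j + 1)) := by
    have h := Finset.sum_range_diag_flip (n + 1) fun k j : ℕ => ((n - k)! : ℂ) / (k ! : ℂ)
      * ((-1) ^ j / ((j ! : ℂ) * ((m + j)! : ℂ))) * (w ^ (2 * (k + j)) * w ^ m * (w ^ (n + 1))⁻¹)
    refine Eq.trans ?_ (h.trans ?_)
    · refine Finset.sum_congr rfl fun l _ => ?_
      rw [Finset.sum_mul]
      refine Finset.sum_congr rfl fun k hk => ?_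
      rw [Nat.add_sub_of_le (Nat.lt_succ_iff.1 (Finset.mem_range.1 hk))]
    · refine Finset.sum_congr rfl fun k _ => ?_
      rw [Finset.mul_sum, Finset.mul_sum]
      refine Finset.sum_congr rfl fun j _ => ?_
      have := invGamma_nat_add_one (m + j)
      push_cast at this
      rw [this, mul_add 2 k j, pow_add]
      field_simp
  rw [hflip, besselJ_two_mul, Complex.cpow_natCast]
  simp only [Finset.sum_apply, mul_sub, Finset.sum_sub_distrib, mul_add, Finset.mul_sum]
  have e : ∀ a b c : ℂ, a + b - (b - c) = a + c := fun a b c => by ring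
  have e1 : ∑ k ∈ Finset.range (n + 1), w ^ m * evenSeries (fun k => invGamma (m + k + 1)) w
        * (((n - k)! : ℂ) / (k ! : ℂ) * w ^ (2 * k) * (w ^ (n + 1))⁻¹)
      = ∑ k ∈ Finset.range (n + 1), ((n - k)! : ℂ) / (k ! : ℂ) * (w ^ m * w ^ (2 * k)
        * (w ^ (n + 1))⁻¹ * evenSeries (fun k => invGamma (m + k + 1)) w) :=
    Finset.sum_congr rfl fun k _ => by ring
  rw [e1, e]
  congr 1
  ring

theorem mainTheorem10 (m n : ℕ) (hmn : m ≤ n) :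
    (fun w : ℂ =>
      (Real.pi : ℂ) * besselJ m (2 * w) * besselY ((n : ℂ) + 1) (2 * w)
        - (-((n ! : ℂ) / (m ! : ℂ)) * w ^ ((m : ℤ) - (n : ℤ) - 1)
              * frakFFin (fun k : Fin (n - m) => w / ((m : ℂ) + 1 + ((k : ℕ) : ℂ)))
            - ∑ s ∈ Finset.range m,
                (((m - s - 1)! : ℂ) * ((n - m + 2 * s + 1)! : ℂ))
                  / ((s ! : ℂ) * ((n + s + 1)! : ℂ) * ((n - m + s + 1)! : ℂ))
                  * w ^ (n - m + 2 * s + 1)))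
      =O[𝓝[≠] (0 : ℂ)] (fun w : ℂ => w ^ (m + n + 1) * Complex.log w) := by
  refine (pi_mul_besselJ_mul_besselY_isBigO m n).congr' ?_ EventuallyEq.rfl
  filter_upwards [self_mem_nhdsWithin] with w hw
  have hw' : w ≠ 0 := hw
  have hf : ∀ k : ℕ, (k ! : ℂ) ≠ 0 := fun k => by exact_mod_cast Nat.factorial_ne_zero k
  have hz : w ^ ((m : ℤ) - (n : ℤ) - 1) = w ^ m * (w ^ (n + 1))⁻¹ := by
    rw [sub_sub, zpow_sub₀ hw', zpow_natCast, ← Nat.cast_succ, zpow_natCast, div_eq_mul_inv]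
  have hsplit : n + 1 = (n - m + 1) + m := by omega
  rw [sub_eq_add_neg ((Real.pi : ℂ) * _ * _)]
  congr 1
  -- The indices l ≤ n - m produce 𝔉; the remaining m indices produce the second sum.
  conv_lhs => rw [show Finset.range (n + 1) = Finset.range ((n - m + 1) + m) by rw [← hsplit]]
  rw [Finset.sum_range_add, neg_sub, sub_eq_add_neg, add_comm]
  congr 1
  · refine Finset.sum_congr rfl fun s hs => ?_
    have hs' := Finset.mem_range.1 hs
    have h1 : n - m + 1 + s = n - m + s + 1 := by ring
    rw [h1, sum_factorial_alternating_of_lt m n s hmn hs', ← pow_add,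
      show 2 * (n - m + s + 1) + m = (n - m + 2 * s + 1) + (n + 1) by omega, pow_add,
      mul_inv_cancel_right₀ (pow_ne_zero _ hw')]
  · rw [frakFFin_arith, hz, Nat.add_sub_of_le hmn, neg_mul, neg_mul, neg_neg, Finset.mul_sum]
    refine Finset.sum_congr rfl fun l hl => ?_
    have hl' := Finset.mem_range.1 hl
    rw [sum_factorial_alternating_of_le m n l (by omega)]
    have := hf n; have := hf m; have := hf (m + l)
    field_simp
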